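/- Let $L$ be a (possibly many-sorted) first-order language and let $\mathbb M$ be a saturated $L$-structure (the monster model of its complete theory), that is, every complete type in finitely many variables over a set $A\subseteq\mathbb M$ which is small, meaning $|A|<|\mathbb M|$, is realized in $\mathbb M$. Let $A\subseteq \mathbb M$ be small, let $p\in S(A)$ be a complete type in finitely many variables, and let $p(\mathbb M)$ be the set of its realizations in $\mathbb M$. A subset of $p(\mathbb M)$ is *relatively definable* if it is the intersection of $p(\mathbb M)$ with a set definable in $\mathbb M$ with parameters. A binary relation on $p(\mathbb M)$ is *relatively $A$-definable* if it is the intersection of $p(\mathbb M)\times p(\mathbb M)$ with a set defined by an $L_A$-formula. For a relatively $A$-definable (strict) linear order $<$ on $p(\mathbb M)$, the pair $(p,<)$ is a *weakly o-minimal pair over $A$* if every relatively definable subset $D$ of $p(\mathbb M)$ has finitely many convex components (maximal convex subsets of $D$) with respect to $<$. The type $p$ is *weakly o-minimal* if $(p,<)$ is a weakly o-minimal pair over $A$ for some relatively $A$-definable linear order $<$ on $p(\mathbb M)$. **Corollary.** If $(p,<)$ is a weakly o-minimal pair over $A$, then $(p,\triangleleft)$ is a weakly o-minimal pair over $A$ for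 every relatively $A$-definable linear order $\triangleleft$ on $p(\mathbb M)$. Thus weak o-minimality of a type does not depend on the choice of the order: for every relatively $A$-definable linear order $\triangleleft$ on $p(\mathbb M)$, the type $p$ is weakly o-minimal if and only if $(p,\triangleleft)$ is a weakly o-minimal pair over $A$. -/

import Mathlib

universe u v v' w x

/-- A first-order language whose set of sorts is `S`: function symbols with a list of argument
sorts and a value sort (constants have the empty list), relation symbols with a list of argument
sorts. The one-sorted case is `S = Unit`. -/
structure SortedLanguage (S : Type u) where
  Fn : List S → S → Type v
  Rel : List S → Type v'

namespace SortedLanguage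

variable {S : Type u}

/-- Interpretation of the symbols of `L` in a family of carriers, one for each sort. -/
class Struct (L : SortedLanguage.{u, v, v'} S) (M : S → Type w) where
  fnMap : ∀ {l : List S} {s : S}, L.Fn l s → (∀ i : Fin l.length, M (l.get i)) → M s
  relMap : ∀ {l : List S}, L.Rel l → (∀ i : Fin l.length, M (l.get i)) → Prop

/-- Terms, indexed by their sort. The free variables are the elements of `V`, with `τ i` the sort
of the variable `i`; `Γ` lists the sorts of the bound variables in scope. -/
inductive Term (L : SortedLanguage.{u, v, v'} S) {V : Type x} (τ : V → S) (Γ : List S) :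
    S → Type (max u v x)
  | var (i : V) : Term L τ Γ (τ i)
  | bvar (i : Fin Γ.length) : Term L τ Γ (Γ.get i)
  | app {l : List S} {s : S} (f : L.Fn l s) (ts : ∀ i : Fin l.length, Term L τ Γ (l.get i)) :
      Term L τ Γ s

/-- First-order formulas with free variables `V` sorted by `τ` and, in addition, bound variables
in scope of sorts `Γ`. The quantifier `all s` binds a new variable of sort `s`. -/
inductive BFormula (L : SortedLanguage.{u, v, v'} S) {V : Type x} (τ : V → S) :
    List S → Type (max u v v' x)
  | falsum {Γ : List S} : BFormula L τ Γ
  | equal {Γ : List S} {s : S} (t₁ t₂ : Term L τ Γ s) : BFormula L τ Γ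
  | rel {Γ : List S} {l : List S} (R : L.Rel l)
      (ts : ∀ i : Fin l.length, Term L τ Γ (l.get i)) : BFormula L τ Γ
  | imp {Γ : List S} (φ ψ : BFormula L τ Γ) : BFormula L τ Γ
  | all {Γ : List S} (s : S) (φ : BFormula L τ (s :: Γ)) : BFormula L τ Γ

/-- Negation. -/
def BFormula.not {L : SortedLanguage.{u, v, v'} S} {V : Type x} {τ : V → S} {Γ : List S}
    (φ : BFormula L τ Γ) : BFormula L τ Γ :=
  φ.imp BFormula.falsum

section Semantics

variable {L : SortedLanguage.{u, v, v'} S} (M : S → Type w) [Struct L M]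

/-- Value of a term under an assignment `a` of the free and `b` of the bound variables. -/
def Term.eval {V : Type x} {τ : V → S} {Γ : List S} (a : ∀ i : V, M (τ i))
    (b : ∀ i : Fin Γ.length, M (Γ.get i)) : ∀ {s : S}, Term L τ Γ s → M s
  | _, .var i => a i
  | _, .bvar i => b i
  | _, .app f ts => Struct.fnMap f (fun i => (ts i).eval a b)

/-- Tarskian truth of a formula under an assignment. -/
def BFormula.Holds {V : Type x} {τ : V → S} (a : ∀ i : V, M (τ i)) :
    ∀ {Γ : List S}, BFormula L τ Γ → (∀ i : Fin Γ.length, M (Γ.get i)) → Prop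
  | _, .falsum, _ => False
  | _, .equal t₁ t₂, b => t₁.eval M a b = t₂.eval M a b
  | _, .rel R ts, b => Struct.relMap R (fun i => (ts i).eval M a b)
  | _, .imp φ ψ, b => φ.Holds a b → ψ.Holds a b
  | Γ, .all s φ, b =>
      ∀ c : M s, φ.Holds a (Fin.cons (α := fun i => M ((s :: Γ).get i)) c b)

end Semantics

/-- Tuples of elements of the structure `M` of sorts `τ`. -/
abbrev Tuple (M : S → Type w) {V : Type x} (τ : V → S) : Type (max x w) :=
  ∀ i : V, M (τ i)

/-- The concatenation of two tuples. -/
def Tuple.pair {M : S → Type w} {V W : Type x} {τ : V → S} {σ : W → S}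
    (a : Tuple M τ) (b : Tuple M σ) : Tuple M (Sum.elim τ σ) :=
  fun i => match i with
    | .inl j => a j
    | .inr j => b j

/-- `L_A`-formulas in the free variables `V`, sorted by `τ`: formulas in which, besides the
variables `V`, the elements of the parameter set `A` may occur as names of themselves. -/
abbrev FormulaOver (L : SortedLanguage.{u, v, v'} S) {M : S → Type w} (A : Set (Σ s, M s))
    {V : Type x} (τ : V → S) : Type (max u v v' x w) :=
  BFormula L (Sum.elim τ (fun c : A => c.1.1)) []

section Definability

variable {L : SortedLanguage.{u, v, v'} S} {M : S → Type w} [Struct L M]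

/-- `M ⊨ φ(a)` for an `L_A`-formula `φ` and a tuple `a`; each parameter denotes itself. -/
def FormulaOver.Sat {A : Set (Σ s, M s)} {V : Type x} {τ : V → S}
    (φ : FormulaOver L A τ) (a : Tuple M τ) : Prop :=
  BFormula.Holds M
    (fun i => match i with
      | .inl j => a j
      | .inr c => c.1.2)
    φ (fun i => i.elim0)

variable (L) in
/-- The set `D` of tuples is `B`-definable. -/
def DefinableOver (B : Set (Σ s, M s)) {V : Type x} {τ : V → S} (D : Set (Tuple M τ)) : Prop :=
  ∃ φ : FormulaOver L B τ, D = {a | φ.Sat a}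

variable (L) in
/-- The subset `X` of `P` is relatively `B`-definable within `P`. -/
def RelDefinableSet (B : Set (Σ s, M s)) {V : Type x} {τ : V → S} {P : Set (Tuple M τ)}
    (X : Set P) : Prop :=
  ∃ D : Set (Tuple M τ), DefinableOver L B D ∧ ∀ a : P, a ∈ X ↔ a.1 ∈ D

variable (L) in
/-- The binary relation `R` on `P` is relatively `B`-definable within `P × P`. -/
def RelDefinableRel (B : Set (Σ s, M s)) {V : Type x} {τ : V → S} {P : Set (Tuple M τ)}
    (R : P → P → Prop) : Prop :=
  ∃ D : Set (Tuple M (Sum.elim τ τ)), DefinableOver L B D ∧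
    ∀ a b : P, R a b ↔ Tuple.pair a.1 b.1 ∈ D

variable (L) in
/-- `R` is a relatively `B`-definable (strict) linear order on `P`. -/
def IsRelDefinableLinearOrder (B : Set (Σ s, M s)) {V : Type x} {τ : V → S}
    {P : Set (Tuple M τ)} (R : P → P → Prop) : Prop :=
  RelDefinableRel L B R ∧ IsStrictTotalOrder P R

/-- `C` is convex with respect to `R`. -/
def IsConvexFor {X : Type x} (R : X → X → Prop) (C : Set X) : Prop :=
  ∀ a ∈ C, ∀ b ∈ C, ∀ c, R a c → R c b → c ∈ C

/-- `C` is a convex component of `D`: a maximal convex subset of `D`. -/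
def IsConvexComponent {X : Type x} (R : X → X → Prop) (D C : Set X) : Prop :=
  Maximal (fun C' : Set X => C' ⊆ D ∧ IsConvexFor R C') C

variable (L) in
/-- Every subset of `P` which is relatively definable (with arbitrary parameters) has finitely
many convex components with respect to `R`. -/
def IsWeaklyOMinimalOrder {V : Type x} {τ : V → S} {P : Set (Tuple M τ)}
    (R : P → P → Prop) : Prop :=
  ∀ X : Set P, RelDefinableSet L (Set.univ : Set (Σ s, M s)) X →
    {C : Set P | IsConvexComponent R X C}.Finite

variable (L M) in
/-- Complete types over `A` in the finitely many variables sorted by `τ`: sets of `L_A`-formulas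
which are finitely satisfiable in `M` and contain each `L_A`-formula or its negation. -/
structure CompleteType (A : Set (Σ s, M s)) {n : ℕ} (τ : Fin n → S) where
  formulas : Set (FormulaOver L A τ)
  finitelySatisfiable : ∀ F : Set (FormulaOver L A τ), F ⊆ formulas → F.Finite →
    ∃ a : Tuple M τ, ∀ φ ∈ F, φ.Sat a
  complete : ∀ φ : FormulaOver L A τ, φ ∈ formulas ∨ φ.not ∈ formulas

/-- The set of realizations in `M` of a type. -/
def CompleteType.locus {A : Set (Σ s, M s)} {n : ℕ} {τ : Fin n → S}
    (p : CompleteType L M A τ) : Set (Tuple M τ) :=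
  {a | ∀ φ ∈ p.formulas, φ.Sat a}

/-- A set of elements of `M` is small if its cardinality is less than that of `M`. -/
def IsSmall (A : Set (Σ s, M s)) : Prop :=
  Cardinal.mk A < Cardinal.mk (Σ s, M s)

variable (L M) in
/-- `M` is saturated: every complete type in finitely many variables over a small set of
parameters is realized in `M`. -/
def IsSaturated : Prop :=
  ∀ A : Set (Σ s, M s), IsSmall A → ∀ (n : ℕ) (τ : Fin n → S) (p : CompleteType L M A τ),
    p.locus.Nonempty

/-- `(p, R)` is a weakly o-minimal pair over `A`. -/
def IsWeaklyOMinimalPair {A : Set (Σ s, M s)} {n : ℕ} {τ : Fin n → S}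
    (p : CompleteType L M A τ) (R : p.locus → p.locus → Prop) : Prop :=
  IsRelDefinableLinearOrder L A R ∧ IsWeaklyOMinimalOrder L R

/-- The type `p` over `A` is weakly o-minimal. -/
def CompleteType.IsWeaklyOMinimal {A : Set (Σ s, M s)} {n : ℕ} {τ : Fin n → S}
    (p : CompleteType L M A τ) : Prop :=
  ∃ R : p.locus → p.locus → Prop, IsWeaklyOMinimalPair p R

end Definability

end SortedLanguage

/-! Having finitely many convex components amounts to being decided by finitely many lower sets
(`isFinitelyCut_of_finite_components`, `IsFinitelyCut.finite_components`). So it suffices that every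
`<`-lower set, definable or not, is finitely cut for the second order `tri`. Only two facts about
the locus are needed: each `{z | tri a z}` is finitely cut for `<`, and the finite partial
elementary maps over `A` form a back-and-forth system matching any two realizations.

Along `<`, membership in `{z | tri a z}` changes boundedly often, uniformly in `a` by homogeneity,
and is eventually constant; after reversing `tri` if necessary, the two orders eventually agree
about `a`. The points above `a` that have a disagreement with `a` at or beyond them form an initial
segment above `a`. Homogeneity makes lying in such a segment a convex equivalence relation
(`BackAndForth.disagreeBeyond_mono`, `BackAndForth.disagreeBeyond_trans`), and between distinct
classes the two orders agree.

A `<`-lower set splits at most one class, so the problem reduces to that class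
(`isFinitelyCut_of_class`). There the bound on alternations drops by one
(`alternates_succ_of_class`), and induction on the bound concludes. -/

/-- `I` is downward closed with respect to `R`. -/
def IsLowerFor {P : Type*} (R : P → P → Prop) (I : Set P) : Prop :=
  ∀ x ∈ I, ∀ y, R y x → y ∈ I

/-- Membership in `X` is decided by membership in finitely many `R`-lower sets. -/
def IsFinitelyCut {P : Type*} (R : P → P → Prop) (X : Set P) : Prop :=
  ∃ 𝓘 : Finset (Set P), (∀ I ∈ 𝓘, IsLowerFor R I) ∧
    ∀ x y, (∀ I ∈ 𝓘, (x ∈ I ↔ y ∈ I)) → (x ∈ X ↔ y ∈ X)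

/-! ### Closure properties of finitely cut sets -/

namespace IsFinitelyCut

variable {P : Type*} {R R' : P → P → Prop} {X Y : Set P}

theorem of_isLowerFor (h : IsLowerFor R X) : IsFinitelyCut R X :=
  ⟨{X}, by simpa using h, fun x y h => h X (by simp)⟩

theorem inter (hX : IsFinitelyCut R X) (hY : IsFinitelyCut R Y) : IsFinitelyCut R (X ∩ Y) := by
  classical
  obtain ⟨𝓘, h1, h2⟩ := hX
  obtain ⟨𝓙, h3, h4⟩ := hY
  refine ⟨𝓘 ∪ 𝓙, fun I hI => (Finset.mem_union.1 hI).elim (h1 I) (h3 I), fun x y h => ?_⟩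
  exact and_congr (h2 x y fun I hI => h I (Finset.mem_union_left _ hI))
    (h4 x y fun I hI => h I (Finset.mem_union_right _ hI))

/-- This is the reduction to lower sets: afterwards the definability of `X` plays no role. -/
theorem trans (hX : IsFinitelyCut R X) (h : ∀ I, IsLowerFor R I → IsFinitelyCut R' I) :
    IsFinitelyCut R' X := by
  classical
  obtain ⟨𝓘, h1, h2⟩ := hX
  choose! F hF1 hF2 using fun I hI => h I (h1 I hI)
  refine ⟨𝓘.biUnion F, fun J hJ => ?_, fun x y hxy => h2 x y fun I hI => ?_⟩
  · obtain ⟨I, hI, hJ⟩ := Finset.mem_biUnion.1 hJ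
    exact hF1 I hI J hJ
  · exact hF2 I hI x y fun J hJ => hxy J (Finset.mem_biUnion.2 ⟨I, hI, hJ⟩)

theorem preimage_val {Z : Set P} (hX : IsFinitelyCut R X) :
    IsFinitelyCut (fun a b : Z => R a b) (Subtype.val ⁻¹' X) := by
  classical
  obtain ⟨𝓘, h1, h2⟩ := hX
  refine ⟨𝓘.image (fun I => Subtype.val ⁻¹' I), ?_, fun x y h => h2 x y fun I hI => ?_⟩
  · simp only [Finset.mem_image]
    rintro _ ⟨I, hI, rfl⟩ x hx y hxy
    exact h1 I hI x hx y hxy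
  · exact h _ (Finset.mem_image_of_mem _ hI)

theorem swap [IsStrictTotalOrder P R] (hX : IsFinitelyCut (Function.swap R) X) :
    IsFinitelyCut R X := by
  classical
  obtain ⟨𝓘, h1, h2⟩ := hX
  refine ⟨𝓘.image compl, ?_, fun x y h => h2 x y fun I hI => ?_⟩
  · simp only [Finset.mem_image]
    rintro _ ⟨I, hI, rfl⟩ x hx y hxy hy
    exact hx (h1 I hI y hy x hxy)
  · exact not_iff_not.1 (h _ (Finset.mem_image_of_mem _ hI))

end IsFinitelyCut

/-! ### Finitely many convex components versus finitely cut -/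

section Components

open SortedLanguage

variable {P : Type x} {R : P → P → Prop} [IsStrictTotalOrder P R] {X : Set P}

theorem SortedLanguage.IsConvexFor.union {C C' : Set P} (hC : IsConvexFor R C) (hC' : IsConvexFor R C')
    {z : P} (hz : z ∈ C) (hz' : z ∈ C') : IsConvexFor R (C ∪ C') := by
  have key : ∀ C C' : Set P, IsConvexFor R C → IsConvexFor R C' → z ∈ C → z ∈ C' →
      ∀ a ∈ C, ∀ b ∈ C', ∀ c, R a c → R c b → c ∈ C ∪ C' := by
    intro C C' hC hC' hz hz' a ha b hb c hac hcb
    rcases trichotomous_of R c z with h | rfl | h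
    · exact Or.inl (hC a ha z hz c hac h)
    · exact Or.inl hz
    · exact Or.inr (hC' z hz' b hb c h hcb)
  rintro a (ha | ha) b (hb | hb) c hac hcb
  · exact Or.inl (hC a ha b hb c hac hcb)
  · exact key C C' hC hC' hz hz' a ha b hb c hac hcb
  · exact Set.union_comm C C' ▸ key C' C hC' hC hz' hz a ha b hb c hac hcb
  · exact Or.inr (hC' a ha b hb c hac hcb)

theorem exists_isConvexComponent {z : P} (hz : z ∈ X) : ∃ C, IsConvexComponent R X C ∧ z ∈ C := by
  let C : Set P := ⋃₀ {D | D ⊆ X ∧ IsConvexFor R D ∧ z ∈ D}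
  have hsub : C ⊆ X := Set.sUnion_subset fun D hD => hD.1
  have hz0 : IsConvexFor R ({z} : Set P) := by
    rintro a rfl b rfl c h1 h2
    exact (asymm_of R h1 h2).elim
  have hzC : z ∈ C := ⟨{z}, ⟨by simpa using hz, hz0, rfl⟩, rfl⟩
  have hconv : IsConvexFor R C := by
    rintro a ⟨D, hD, ha⟩ b ⟨D', hD', hb⟩ c hac hcb
    exact ⟨D ∪ D', ⟨Set.union_subset hD.1 hD'.1, hD.2.1.union hD'.2.1 hD.2.2 hD'.2.2,
      Or.inl hD.2.2⟩, hD.2.1.union hD'.2.1 hD.2.2 hD'.2.2 a (Or.inl ha) b (Or.inr hb) c hac hcb⟩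
  exact ⟨C, ⟨⟨hsub, hconv⟩, fun D hD hCD => Set.subset_sUnion_of_mem ⟨hD.1, hD.2, hCD hzC⟩⟩, hzC⟩

/-- A component is its downward closure `U C` minus the set `V C` of points strictly below all of
it, so two lower sets per component suffice. -/
theorem isFinitelyCut_of_finite_components (h : {C : Set P | IsConvexComponent R X C}.Finite) :
    IsFinitelyCut R X := by
  classical
  let U : Set P → Set P := fun C => {y | ∃ c ∈ C, y = c ∨ R y c}
  let V : Set P → Set P := fun C => {y | ∀ c ∈ C, R y c}
  refine ⟨h.toFinset.image U ∪ h.toFinset.image V, ?_, ?_⟩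
  · intro I hI
    simp only [Finset.mem_union, Finset.mem_image] at hI
    rcases hI with ⟨C, -, rfl⟩ | ⟨C, -, rfl⟩
    · rintro y ⟨c, hc, rfl | hyc⟩ y' hy'
      · exact ⟨_, hc, Or.inr hy'⟩
      · exact ⟨c, hc, Or.inr (trans_of R hy' hyc)⟩
    · exact fun y hy y' hy' c hc => trans_of R hy' (hy c hc)
  · have key : ∀ x y, (∀ I ∈ h.toFinset.image U ∪ h.toFinset.image V, (x ∈ I ↔ y ∈ I)) →
        x ∈ X → y ∈ X := by
      intro x y hxy hx
      obtain ⟨C, hC, hxC⟩ := exists_isConvexComponent (R := R) hx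
      have hU : y ∈ U C := (hxy _ (Finset.mem_union_left _
        (Finset.mem_image_of_mem _ (h.mem_toFinset.2 hC)))).1 ⟨x, hxC, Or.inl rfl⟩
      have hV : y ∉ V C := fun hy => irrefl_of R x ((hxy _ (Finset.mem_union_right _
        (Finset.mem_image_of_mem _ (h.mem_toFinset.2 hC)))).2 hy x hxC)
      obtain ⟨c, hc, rfl | hyc⟩ := hU
      · exact hC.1.1 hc
      · simp only [V, Set.mem_ofPred_eq, not_forall] at hV
        obtain ⟨d, hd, hyd⟩ := hV
        rcases trichotomous_of R y d with h' | rfl | h'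
        · exact (hyd h').elim
        · exact hC.1.1 hd
        · exact hC.1.1 (hC.1.2 d hd c hc y h' hyc)
    exact fun x y hxy => ⟨key x y hxy, key y x fun I hI => (hxy I hI).symm⟩

/-- Points lying in the same members of the finite family form a convex set, contained in `X` or
disjoint from it. A component meeting such a set contains it, so components are unions of finitely
many such sets. -/
theorem IsFinitelyCut.finite_components (h : IsFinitelyCut R X) :
    {C : Set P | IsConvexComponent R X C}.Finite := by
  classical
  obtain ⟨𝓘, h1, h2⟩ := h
  let t : P → Set 𝓘 := fun x => {I | x ∈ I.1}
  have ht : ∀ x y, t x = t y → ∀ I ∈ 𝓘, (x ∈ I ↔ y ∈ I) := fun x y hxy I hI =>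
    Set.ext_iff.1 hxy ⟨I, hI⟩
  refine (Set.finite_range fun T : Set (Set 𝓘) => t ⁻¹' T).subset ?_
  intro C hC
  refine ⟨t '' C, Set.Subset.antisymm ?_ (Set.subset_preimage_image t C)⟩
  rintro y ⟨z, hz, hzy⟩
  have hconv : IsConvexFor R (t ⁻¹' {t z}) := by
    rintro a ha b hb c hac hcb
    ext ⟨I, hI⟩
    have haz := ht a z ha I hI
    have hbz := ht b z hb I hI
    exact ⟨fun hc => haz.1 (h1 I hI c hc a hac), fun hz => h1 I hI b (hbz.2 hz) c hcb⟩
  have hsub : t ⁻¹' {t z} ⊆ X := fun a ha => (h2 a z (ht a z ha)).2 (hC.1.1 hz)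
  exact hC.2 ⟨Set.union_subset hC.1.1 hsub, hC.1.2.union hconv hz rfl⟩ Set.subset_union_left
    (Or.inr hzy.symm)

end Components

/-! ### Counting alternations along the order -/

section Alternation

variable {P : Type*} [LinearOrder P]

/-- Some increasing sequence starting at `y` changes `n` times between `Q` and its complement. -/
def Alternates (Q : P → Prop) : ℕ → P → Prop
  | 0, _ => True
  | n + 1, y => ∃ y', y < y' ∧ (Q y' ↔ ¬ Q y) ∧ Alternates Q n y'

/-- Going up, each change of `Q` leaves at least one of the finitely many lower sets, and none is
ever re-entered. -/
theorem IsFinitelyCut.exists_not_alternates {Q : P → Prop}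
    (h : IsFinitelyCut (· < ·) {z | Q z}) : ∃ n, ∀ y, ¬ Alternates Q n y := by
  classical
  obtain ⟨𝓘, h1, h2⟩ := h
  have key : ∀ n y, Alternates Q n y → n ≤ (𝓘.filter (y ∈ ·)).card := by
    intro n
    induction n with
    | zero => exact fun _ _ => Nat.zero_le _
    | succ n ih =>
      rintro y ⟨y', hlt, hQ, hn⟩
      refine Nat.succ_le_of_lt ((ih y' hn).trans_lt (Finset.card_lt_card ?_))
      refine ⟨fun I hI => ?_, fun hsub => ?_⟩
      · simp only [Finset.mem_filter] at hI ⊢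
        exact ⟨hI.1, h1 I hI.1 y' hI.2 y hlt⟩
      · have : y ∈ {z | Q z} ↔ y' ∈ {z | Q z} := h2 y y' fun I hI =>
          ⟨fun hy => (Finset.mem_filter.1 (hsub (Finset.mem_filter.2 ⟨hI, hy⟩))).2,
            fun hy' => h1 I hI y' hy' y hlt⟩
        simp only [Set.mem_ofPred_eq] at this
        tauto
  refine ⟨𝓘.card + 1, fun y hy => ?_⟩
  have := (key _ y hy).trans (Finset.card_filter_le _ _)
  omega

theorem IsFinitelyCut.eventually_constant {Q : P → Prop}
    (h : IsFinitelyCut (· < ·) {z | Q z}) {J : Set P} (hJ : J.Nonempty) :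
    ∃ y ∈ J, ∀ z ∈ J, y ≤ z → (Q z ↔ Q y) := by
  classical
  obtain ⟨n, hn⟩ := h.exists_not_alternates
  by_contra! hcon
  have : ∀ n, ∀ y ∈ J, Alternates Q n y := by
    intro n
    induction n with
    | zero => exact fun _ _ => trivial
    | succ n ih =>
      intro y hy
      obtain ⟨z, hz, hyz, hQ⟩ := hcon y hy
      refine ⟨z, lt_of_le_of_ne hyz ?_, by tauto, ih z hz⟩
      rintro rfl
      tauto
  exact hJ.elim fun y hy => hn y (this n y hy)

theorem Alternates.of_iff_not {Q Q' : P → Prop} {n : ℕ} {y : P}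
    (h : ∀ z, y ≤ z → (Q z ↔ ¬ Q' z)) (hn : Alternates Q n y) : Alternates Q' n y := by
  induction n generalizing y with
  | zero => trivial
  | succ n ih =>
    obtain ⟨y', hlt, hQ, hn⟩ := hn
    refine ⟨y', hlt, ?_, ih (fun z hz => h z (hlt.le.trans hz)) hn⟩
    have := h y le_rfl
    have := h y' hlt.le
    tauto

end Alternation

/-! ### Back-and-forth systems and transfer of alternations -/

/-- A back-and-forth system of sets of pairs preserving two relations, in which any two points
correspond. -/
structure BackAndForth {P : Type*} (r tri : P → P → Prop) (R : Set (P × P) → Prop) : Prop where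
  base : ∀ a b, R {(a, b)}
  forth : ∀ S, R S → S.Nonempty → ∀ c, ∃ d, R (insert (c, d) S)
  back : ∀ S, R S → S.Nonempty → ∀ d, ∃ c, R (insert (c, d) S)
  map_lt : ∀ S, R S → ∀ a ∈ S, ∀ b ∈ S, (r a.1 b.1 ↔ r a.2 b.2)
  map_tri : ∀ S, R S → ∀ a ∈ S, ∀ b ∈ S, (tri a.1 b.1 ↔ tri a.2 b.2)

section Homogeneous

variable {P : Type*} [LinearOrder P] {tri : P → P → Prop} {R : Set (P × P) → Prop}

theorem BackAndForth.map_le (H : BackAndForth (· < ·) tri R) {S : Set (P × P)} (hS : R S)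
    {a b a' b' : P} (ha : (a, a') ∈ S) (hb : (b, b') ∈ S) : a ≤ b ↔ a' ≤ b' := by
  have := H.map_lt S hS _ hb _ ha
  simpa using not_congr this

theorem BackAndForth.alternates (H : BackAndForth (· < ·) tri R) {w w' : P} {Q Q' : P → Prop}
    (hQ : ∀ S, R S → (w, w') ∈ S → ∀ y y', (y, y') ∈ S → (Q y ↔ Q' y')) {n : ℕ} {y y' : P}
    {S : Set (P × P)} (hS : R S) (hw : (w, w') ∈ S) (hy : (y, y') ∈ S)
    (hn : Alternates Q n y) : Alternates Q' n y' := by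
  induction n generalizing y y' S with
  | zero => trivial
  | succ n ih =>
    obtain ⟨z, hlt, hz, hn⟩ := hn
    obtain ⟨z', hS'⟩ := H.forth S hS ⟨_, hy⟩ z
    have hzm : (z, z') ∈ insert (z, z') S := Set.mem_insert _ _
    have hym : (y, y') ∈ insert (z, z') S := Or.inr hy
    have hwm : (w, w') ∈ insert (z, z') S := Or.inr hw
    refine ⟨z', (H.map_lt _ hS' _ hym _ hzm).1 hlt, ?_, ih hS' hwm hzm hn⟩
    rw [← hQ _ hS' hwm _ _ hym, ← hQ _ hS' hwm _ _ hzm, hz]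

omit [LinearOrder P] in
theorem BackAndForth.swap {r : P → P → Prop} (H : BackAndForth r tri R) :
    BackAndForth r (Function.swap tri) R :=
  ⟨H.base, H.forth, H.back, H.map_lt, fun S hS a ha b hb => H.map_tri S hS b hb a ha⟩

/-! ### The disagreement relation and its equivalence classes -/

/-- Some element at or above `y` is above `x` for the first order and below `x` for the second. -/
def DisagreeBeyond (tri : P → P → Prop) (x y : P) : Prop :=
  x < y ∧ ∃ z, y ≤ z ∧ tri z x

theorem DisagreeBeyond.of_le {x y z : P} (h : DisagreeBeyond tri x z) (hxy : x < y) (hyz : y ≤ z) :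
    DisagreeBeyond tri x y :=
  ⟨hxy, h.2.imp fun _ hw => ⟨hyz.trans hw.1, hw.2⟩⟩

theorem BackAndForth.disagreeBeyond (H : BackAndForth (· < ·) tri R) {S : Set (P × P)} (hS : R S)
    {a b a' b' : P} (ha : (a, a') ∈ S) (hb : (b, b') ∈ S) :
    DisagreeBeyond tri a b ↔ DisagreeBeyond tri a' b' := by
  constructor
  · rintro ⟨hlt, z, hz, hza⟩
    obtain ⟨z', hS'⟩ := H.forth S hS ⟨_, ha⟩ z
    exact ⟨(H.map_lt S hS _ ha _ hb).1 hlt, z',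
      (H.map_le hS' (Or.inr hb) (Set.mem_insert _ _)).1 hz,
      (H.map_tri _ hS' _ (Set.mem_insert _ _) _ (Or.inr ha)).1 hza⟩
  · rintro ⟨hlt, z, hz, hza⟩
    obtain ⟨z', hS'⟩ := H.back S hS ⟨_, ha⟩ z
    exact ⟨(H.map_lt S hS _ ha _ hb).2 hlt, z',
      (H.map_le hS' (Or.inr hb) (Set.mem_insert _ _)).2 hz,
      (H.map_tri _ hS' _ (Set.mem_insert _ _) _ (Or.inr ha)).2 hza⟩

/-- The supremum of the points of disagreement with `a` does not drop when passing to a larger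
point below it. -/
theorem BackAndForth.disagreeBeyond_mono [IsStrictTotalOrder P tri]
    (H : BackAndForth (· < ·) tri R) (hcut : ∀ a, IsFinitelyCut (· < ·) {z | tri a z}) {a b z : P}
    (hab : a < b) (hbz : b < z) (hz : DisagreeBeyond tri a z) : DisagreeBeyond tri b z := by
  by_contra hcon
  -- A drop at `a`: the point `z` disagrees with `a`, but nothing from `z` on disagrees with the
  -- intermediate `b`. Homogeneity turns one drop into a drop at every point.
  let N : P → Prop := fun a => ∃ b z, a < b ∧ b < z ∧ tri z a ∧ ∀ z', z ≤ z' → ¬ tri z' b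
  have hN : N a := by
    obtain ⟨-, z1, hz1, hza⟩ := hz
    exact ⟨b, z1, hab, hbz.trans_le hz1, hza, fun z' hz' ht =>
      hcon ⟨hbz, z', hz1.trans hz', ht⟩⟩
  have hN' : ∀ a', N a' := by
    intro a'
    obtain ⟨b, z, hab, hbz, hza, hall⟩ := hN
    obtain ⟨b', hS1⟩ := H.forth _ (H.base a a') ⟨_, rfl⟩ b
    obtain ⟨z', hS2⟩ := H.forth _ hS1 ⟨_, Or.inl rfl⟩ z
    refine ⟨b', z', (H.map_lt _ hS2 (a, a') (by simp) (b, b') (by simp)).1 hab,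
      (H.map_lt _ hS2 (b, b') (by simp) (z, z') (by simp)).1 hbz,
      (H.map_tri _ hS2 (z, z') (by simp) (a, a') (by simp)).1 hza, fun w' hw' ht => ?_⟩
    obtain ⟨w, hS3⟩ := H.back _ hS2 ⟨_, Or.inl rfl⟩ w'
    exact hall w ((H.map_le hS3 (a := z) (a' := z') (by simp) (by simp)).2 hw')
      ((H.map_tri _ hS3 (w, w') (by simp) (b, b') (by simp)).2 ht)
  let Q : P → P → Prop := fun w z => z < w ∧ tri w z
  -- Drops are chained: with `w` obtained by induction above `z`, one has `tri w z` and `tri z a`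
  -- but not `tri w b`, so `Q w` changes at `b` and again at `z`.
  have halt : ∀ n a, ∃ w, Q w a ∧ Alternates (Q w) (2 * n) a := by
    intro n
    induction n with
    | zero =>
      intro a
      obtain ⟨b, z, hab, hbz, hza, -⟩ := hN' a
      exact ⟨z, ⟨hab.trans hbz, hza⟩, trivial⟩
    | succ n ih =>
      intro a
      obtain ⟨b, z, hab, hbz, hza, hall⟩ := hN' a
      obtain ⟨w, ⟨hzw, hwz⟩, hn⟩ := ih z
      have hQa : Q w a := ⟨(hab.trans hbz).trans hzw, trans_of tri hwz hza⟩
      have hQb : ¬ Q w b := fun h => hall w hzw.le h.2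
      exact ⟨w, hQa, b, hab, by tauto, z, hbz, by simp [hQb, Q, hzw, hwz], hn⟩
  have hQcut : IsFinitelyCut (· < ·) {z | Q a z} :=
    (IsFinitelyCut.of_isLowerFor (X := Set.Iio a) fun x hx y hy => hy.trans hx).inter (hcut a)
  obtain ⟨n, hn⟩ := hQcut.exists_not_alternates
  have hdrop : ∀ m k y, Alternates (Q a) (k + m) y → Alternates (Q a) k y := by
    intro m k
    induction k with
    | zero => exact fun _ _ => trivial
    | succ k ih =>
      intro y hy
      rw [Nat.add_right_comm] at hy
      obtain ⟨y', h1, h2, h3⟩ := hy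
      exact ⟨y', h1, h2, ih y' h3⟩
  -- Matching `w` with the fixed `a` produces `2 * n` changes of `Q a`, although even `n` were
  -- excluded.
  obtain ⟨w, -, hw⟩ := halt n a
  obtain ⟨y, hS⟩ := H.forth _ (H.base w a) ⟨_, rfl⟩ a
  refine hn y (hdrop n n y ?_)
  rw [← two_mul]
  refine H.alternates (w := w) (w' := a) (fun S hS hwS y y' hy => ?_) hS (by simp) (by simp) hw
  exact and_congr (H.map_lt S hS _ hy _ hwS) (H.map_tri S hS _ hwS _ hy)

theorem BackAndForth.disagreeBeyond_trans [IsStrictTotalOrder P tri]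
    (H : BackAndForth (· < ·) tri R) (hcut : ∀ a, IsFinitelyCut (· < ·) {z | tri a z}) {a b z : P}
    (hab : DisagreeBeyond tri a b) (hbz : DisagreeBeyond tri b z) : DisagreeBeyond tri a z := by
  have hne : {z | DisagreeBeyond tri a z}.Nonempty := ⟨b, hab⟩
  obtain ⟨y, hy, hconst⟩ := (hcut a).eventually_constant hne
  -- The segment of `a` contains a disagreement at or past `y`, so the constant value there is
  -- disagreement.
  have hneg : ∀ z, DisagreeBeyond tri a z → y ≤ z → tri z a := by
    obtain ⟨hay, z1, hyz1, hz1⟩ := hy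
    have h1 : ¬ tri a z1 := fun h => asymm_of tri h hz1
    have h2 := hconst z1 ⟨hay.trans_le hyz1, z1, le_rfl, hz1⟩ hyz1
    intro z hz hyz
    have h3 := hconst z hz hyz
    rcases trichotomous_of tri z a with h | rfl | h
    · exact h
    · exact (lt_irrefl _ hz.1).elim
    · tauto
  have hstep : ∀ z w, DisagreeBeyond tri a z → y ≤ z → DisagreeBeyond tri z w →
      DisagreeBeyond tri a w := by
    rintro z w hz hyz ⟨hzw, w', hww', hw'⟩
    exact ⟨hz.1.trans hzw, w', hww', trans_of tri hw' (hneg z hz hyz)⟩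
  -- Transitivity is first proved with `y` as starting point: `hstep` applied twice reaches `z` from
  -- `a`, and monotonicity replaces `a` by `y`. Matching `a` with `y` then gives the claim at `a`.
  have hCy : ∀ b z, DisagreeBeyond tri y b → DisagreeBeyond tri b z → DisagreeBeyond tri y z := by
    intro b z hyb hbz
    have hb := hstep y b hy le_rfl hyb
    exact H.disagreeBeyond_mono hcut hy.1 (hyb.1.trans hbz.1) (hstep b z hb hyb.1.le hbz)
  obtain ⟨b', hS1⟩ := H.forth _ (H.base a y) ⟨_, rfl⟩ b
  obtain ⟨z', hS2⟩ := H.forth _ hS1 ⟨_, Or.inl rfl⟩ z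
  exact (H.disagreeBeyond hS2 (a' := y) (b' := z') (by simp) (by simp)).2
    (hCy b' z' ((H.disagreeBeyond hS2 (a := a) (b := b) (by simp) (by simp)).1 hab)
      ((H.disagreeBeyond hS2 (a := b) (b := z) (by simp) (by simp)).1 hbz))

/-- The equivalence relation of not being separated by the supremum of disagreement. -/
def DisagreeEquiv (tri : P → P → Prop) (x y : P) : Prop :=
  x = y ∨ DisagreeBeyond tri x y ∨ DisagreeBeyond tri y x

theorem DisagreeEquiv.symm {x y : P} (h : DisagreeEquiv tri x y) : DisagreeEquiv tri y x :=
  h.elim (fun h => Or.inl h.symm) fun h => Or.inr h.symm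

theorem BackAndForth.disagreeEquiv (H : BackAndForth (· < ·) tri R) {S : Set (P × P)} (hS : R S)
    {a b a' b' : P} (ha : (a, a') ∈ S) (hb : (b, b') ∈ S) :
    DisagreeEquiv tri a b ↔ DisagreeEquiv tri a' b' := by
  have heq : a = b ↔ a' = b' := by
    rw [le_antisymm_iff, le_antisymm_iff, H.map_le hS ha hb, H.map_le hS hb ha]
  exact or_congr heq (or_congr (H.disagreeBeyond hS ha hb) (H.disagreeBeyond hS hb ha))

/-- Chains use `disagreeBeyond_trans`; two points below a common third use `of_le`, and two points
above it use `disagreeBeyond_mono`. -/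
theorem BackAndForth.disagreeEquiv_trans [IsStrictTotalOrder P tri]
    (H : BackAndForth (· < ·) tri R) (hcut : ∀ a, IsFinitelyCut (· < ·) {z | tri a z}) {x y z : P}
    (hxy : DisagreeEquiv tri x y) (hyz : DisagreeEquiv tri y z) : DisagreeEquiv tri x z := by
  rcases hxy with rfl | hxy | hxy
  · exact hyz
  · rcases hyz with rfl | hyz | hyz
    · exact Or.inr (Or.inl hxy)
    · exact Or.inr (Or.inl (H.disagreeBeyond_trans hcut hxy hyz))
    · rcases lt_trichotomy x z with h | rfl | h
      · exact Or.inr (Or.inl (hxy.of_le h hyz.1.le))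
      · exact Or.inl rfl
      · exact Or.inr (Or.inr (hyz.of_le h hxy.1.le))
  · rcases hyz with rfl | hyz | hyz
    · exact Or.inr (Or.inr hxy)
    · rcases lt_trichotomy x z with h | rfl | h
      · exact Or.inr (Or.inl (H.disagreeBeyond_mono hcut hxy.1 h hyz))
      · exact Or.inl rfl
      · exact Or.inr (Or.inr (H.disagreeBeyond_mono hcut hyz.1 h hxy))
    · exact Or.inr (Or.inr (H.disagreeBeyond_trans hcut hyz hxy))

/-- If the orders disagreed on the pair, `y` itself would be the witness of disagreement. -/
theorem tri_of_lt_of_not_disagreeEquiv [IsStrictTotalOrder P tri] {x y : P} (hlt : x < y)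
    (h : ¬ DisagreeEquiv tri x y) : tri x y := by
  rcases trichotomous_of tri x y with h' | rfl | h'
  · exact h'
  · exact (lt_irrefl _ hlt).elim
  · exact (h (Or.inr (Or.inl ⟨hlt, y, le_rfl, h'⟩))).elim

theorem lt_iff_tri_of_not_disagreeEquiv [IsStrictTotalOrder P tri] {x y : P}
    (h : ¬ DisagreeEquiv tri x y) : x < y ↔ tri x y := by
  refine ⟨fun hlt => tri_of_lt_of_not_disagreeEquiv hlt h, fun ht => ?_⟩
  rcases lt_trichotomy x y with h' | rfl | h'
  · exact h'
  · exact (h (Or.inl rfl)).elim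
  · exact (asymm_of tri ht (tri_of_lt_of_not_disagreeEquiv h' fun h1 => h h1.symm)).elim

theorem DisagreeEquiv.of_lt_of_lt [IsStrictTotalOrder P tri] {x y z : P}
    (hxz : DisagreeEquiv tri x z) (hxy : x < y) (hyz : y < z) : DisagreeEquiv tri x y := by
  rcases hxz with rfl | h | h
  · exact (lt_asymm hxy hyz).elim
  · exact Or.inr (Or.inl (h.of_le hxy hyz.le))
  · exact (lt_asymm h.1 (hxy.trans hyz)).elim

end Homogeneous

/-! ### Restriction to a subset -/

section Restriction

variable {P : Type*} [LinearOrder P] {tri : P → P → Prop} {R : Set (P × P) → Prop}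

omit [LinearOrder P] in
theorem isStrictTotalOrder_restrict [IsStrictTotalOrder P tri] (X : Set P) :
    IsStrictTotalOrder X (fun a b : X => tri a b) where
  trichotomous a b h h' := Subtype.ext (Std.Trichotomous.trichotomous (r := tri) a.1 b.1 h h')
  irrefl a := irrefl_of tri a.1
  trans _ _ _ h h' := trans_of tri h h'

/-- The restriction of a system of sets of pairs to a subset. -/
def restrictSystem (R : Set (P × P) → Prop) (X : Set P) (S : Set (X × X)) : Prop :=
  R (Prod.map Subtype.val Subtype.val '' S)

/-- A pair already present anchors the class, forcing the partner of a point of `X` into `X`. This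
is why extension is only demanded of nonempty sets. -/
theorem BackAndForth.restrict (H : BackAndForth (· < ·) tri R) {X : Set P}
    (hX : ∀ S, R S → ∀ a a' b b', (a, a') ∈ S → (b, b') ∈ S → a ∈ X → a' ∈ X → (b ∈ X ↔ b' ∈ X)) :
    BackAndForth (P := X) (· < ·) (fun a b => tri a b) (restrictSystem R X) where
  base a b := by simpa [restrictSystem] using H.base a.1 b.1
  forth S hS hne c := by
    obtain ⟨d, hd⟩ := H.forth _ hS (hne.image _) c
    obtain ⟨a, ha⟩ := hne
    have hdX : d ∈ X := (hX _ hd a.1 a.2 c d (Or.inr ⟨a, ha, rfl⟩) (by simp) a.1.2 a.2.2).1 c.2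
    exact ⟨⟨d, hdX⟩, by simpa [restrictSystem, Set.image_insert_eq] using hd⟩
  back S hS hne d := by
    obtain ⟨c, hc⟩ := H.back _ hS (hne.image _) d
    obtain ⟨a, ha⟩ := hne
    have hcX : c ∈ X := (hX _ hc a.1 a.2 c d (Or.inr ⟨a, ha, rfl⟩) (by simp) a.1.2 a.2.2).2 d.2
    exact ⟨⟨c, hcX⟩, by simpa [restrictSystem, Set.image_insert_eq] using hc⟩
  map_lt S hS a ha b hb := H.map_lt _ hS _ ⟨a, ha, rfl⟩ _ ⟨b, hb, rfl⟩
  map_tri S hS a ha b hb := H.map_tri _ hS _ ⟨a, ha, rfl⟩ _ ⟨b, hb, rfl⟩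

end Restriction

/-! ### Induction on the number of alternations -/

section Main

variable {P : Type w} [LinearOrder P] {tri : P → P → Prop} {R : Set (P × P) → Prop}

/-- Restricting to a class of `DisagreeEquiv` loses an alternation. -/
theorem alternates_succ_of_class (hev : ∀ a, ∃ z, a < z ∧ ∀ z', z ≤ z' → tri a z')
    [IsStrictTotalOrder P tri] {X : Set P} (hX : ∀ a ∈ X, ∀ b ∈ X, DisagreeEquiv tri a b)
    {n : ℕ} {a y : X} (hay : a < y) (hn : Alternates (fun z : X => tri a z) n y) :
    Alternates (fun z : P => tri a z) (n + 1) y := by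
  induction n generalizing y with
  | zero =>
    have hD : DisagreeBeyond tri a y := by
      rcases hX a a.2 y y.2 with h | h | h
      · exact (hay.ne (Subtype.ext h)).elim
      · exact h
      · exact (lt_asymm h.1 hay).elim
    -- At or past `y` there is a disagreement with `a`, and far enough out only agreement; so
    -- whichever holds at `y`, a further change follows.
    by_cases hy : tri a y
    · obtain ⟨-, z, hyz, hza⟩ := hD
      refine ⟨z, lt_of_le_of_ne hyz ?_, ?_, trivial⟩
      · rintro rfl
        exact asymm_of tri hy hza
      · simp only [hy, not_true, iff_false]
        exact fun h => asymm_of tri h hza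
    · obtain ⟨z, -, hz⟩ := hev a
      refine ⟨z, ?_, by simp [hy, hz z le_rfl], trivial⟩
      by_contra hle
      exact hy (hz y (not_lt.1 hle))
  | succ n ih =>
    obtain ⟨y', hlt, hQ, hn⟩ := hn
    exact ⟨y', hlt, hQ, ih (hay.trans hlt) hn⟩

/-- A lower set is finitely cut for `tri` if its trace on the class it divides is. -/
theorem isFinitelyCut_of_class [IsStrictTotalOrder P tri]
    (H : BackAndForth (· < ·) tri R) (hcut : ∀ a, IsFinitelyCut (· < ·) {z | tri a z})
    {I : Set P} (hI : IsLowerFor (· < ·) I) {x₀ y₀ : P} (hx₀ : x₀ ∈ I) (hy₀ : y₀ ∉ I)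
    (hxy : DisagreeEquiv tri x₀ y₀) {X : Set P} (hXdef : X = {z | DisagreeEquiv tri z x₀})
    (h : IsFinitelyCut (fun a b : X => tri a b) (Subtype.val ⁻¹' I)) :
    IsFinitelyCut tri I := by
  classical
  obtain ⟨𝓘, h1, h2⟩ := h
  have hmem : ∀ z, z ∈ X ↔ DisagreeEquiv tri z x₀ := fun z => by rw [hXdef]; rfl
  have hequiv : ∀ a ∈ X, ∀ b ∈ X, DisagreeEquiv tri a b := fun a ha b hb =>
    H.disagreeEquiv_trans hcut ((hmem a).1 ha) ((hmem b).1 hb).symm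
  have hclass : ∀ a ∈ X, ∀ z, z ∉ X → ¬ DisagreeEquiv tri z a := fun a ha z hz h =>
    hz ((hmem z).2 (H.disagreeEquiv_trans hcut h ((hmem a).1 ha)))
  have hx₀X : x₀ ∈ X := (hmem x₀).2 (Or.inl rfl)
  have hy₀X : y₀ ∈ X := (hmem y₀).2 hxy.symm
  have hconv : ∀ a ∈ X, ∀ b ∈ X, ∀ z, a < z → z < b → z ∈ X := by
    intro a ha b hb z haz hzb
    by_contra hz
    exact hclass a ha z hz ((hequiv a ha b hb).of_lt_of_lt haz hzb).symm
  have hlt : ∀ a ∈ X, ∀ z, z ∉ X → (z < a ↔ tri z a) := fun a ha z hz =>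
    lt_iff_tri_of_not_disagreeEquiv (hclass a ha z hz)
  have hgt : ∀ a ∈ X, ∀ z, z ∉ X → (a < z ↔ tri a z) := fun a ha z hz =>
    lt_iff_tri_of_not_disagreeEquiv fun h => hclass a ha z hz h.symm
  have hside : ∀ a ∈ X, ∀ b ∈ X, ∀ z, z ∉ X → z < a → z < b := by
    intro a ha b hb z hz hza
    rcases lt_trichotomy z b with h | rfl | h
    · exact h
    · exact (hz hb).elim
    · exact (hz (hconv b hb a ha z h hza)).elim
  -- `X` is `U Set.univ` minus `V`; inside `X` the set `U J` is `J` for `J ∈ 𝓘`, and outside `X` the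
  -- set `I` is `V`.
  let U : Set X → Set P := fun J => {z | ∃ j ∈ J, z = j.1 ∨ tri z j}
  let V : Set P := {z | z ∉ X ∧ z < x₀}
  have hVtri : IsLowerFor tri V := by
    rintro z ⟨hzX, hz⟩ y hyz
    have hyX : y ∉ X := fun hy =>
      lt_asymm ((hgt y hy z hzX).2 hyz) (hside x₀ hx₀X y hy z hzX hz)
    exact ⟨hyX, (hlt x₀ hx₀X y hyX).2 (trans_of tri hyz ((hlt x₀ hx₀X z hzX).1 hz))⟩
  refine ⟨insert V (insert (U Set.univ) (𝓘.image U)), ?_, ?_⟩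
  · have hU : ∀ J, IsLowerFor tri (U J) := by
      rintro J z ⟨j, hj, rfl | hz⟩ y hyz
      · exact ⟨j, hj, Or.inr hyz⟩
      · exact ⟨j, hj, Or.inr (trans_of tri hyz hz)⟩
    intro J hJ
    simp only [Finset.mem_insert, Finset.mem_image] at hJ
    rcases hJ with rfl | rfl | ⟨J, -, rfl⟩
    exacts [hVtri, hU _, hU _]
  · intro x y hxy
    have hV := hxy V (by simp)
    have hUu := hxy (U Set.univ) (by simp)
    have hUJ : ∀ J ∈ 𝓘, (x ∈ U J ↔ y ∈ U J) := fun J hJ => hxy _ (by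
      simp only [Finset.mem_insert, Finset.mem_image]
      exact Or.inr (Or.inr ⟨J, hJ, rfl⟩))
    have hmemX : ∀ z, z ∈ X ↔ z ∈ U Set.univ ∧ z ∉ V := by
      intro z
      refine ⟨fun hz => ⟨⟨⟨z, hz⟩, trivial, Or.inl rfl⟩, fun h => h.1 hz⟩, ?_⟩
      rintro ⟨⟨j, -, rfl | hz⟩, hzV⟩
      · exact j.2
      · by_contra hzX
        exact hzV ⟨hzX, hside j j.2 x₀ hx₀X z hzX ((hlt j j.2 z hzX).2 hz)⟩
    have hUmem : ∀ J ∈ 𝓘, ∀ z (hz : z ∈ X), z ∈ U J ↔ (⟨z, hz⟩ : X) ∈ J := by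
      intro J hJ z hz
      refine ⟨?_, fun h => ⟨_, h, Or.inl rfl⟩⟩
      rintro ⟨j, hj, rfl | h⟩
      · exact hj
      · exact h1 J hJ j hj ⟨z, hz⟩ h
    have houtside : ∀ z, z ∉ X → (z ∈ I ↔ z ∈ V) := by
      intro z hz
      refine ⟨fun hzI => ⟨hz, ?_⟩, fun h => hI x₀ hx₀ z h.2⟩
      refine hside y₀ hy₀X x₀ hx₀X z hz ?_
      rcases lt_trichotomy z y₀ with h | rfl | h
      · exact h
      · exact (hz hy₀X).elim
      · exact (hy₀ (hI z hzI y₀ h)).elim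
    have hX : x ∈ X ↔ y ∈ X := by rw [hmemX, hmemX, hV, hUu]
    by_cases hxX : x ∈ X
    · have hyX := hX.1 hxX
      exact h2 ⟨x, hxX⟩ ⟨y, hyX⟩ fun J hJ => by
        rw [← hUmem J hJ, ← hUmem J hJ, hUJ J hJ]
    · rw [houtside x hxX, houtside y fun h => hxX (hX.2 h), hV]

/-- The carrier is quantified inside the induction because the step passes to a class with the
restricted orders. At bound zero no two points are comparable, so there is at most one point. -/
theorem isFinitelyCut_lower_of_not_alternates (n : ℕ) :
    ∀ {P : Type w} [LinearOrder P] {tri : P → P → Prop} [IsStrictTotalOrder P tri]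
      {R : Set (P × P) → Prop} (_ : BackAndForth (· < ·) tri R)
      (_ : ∀ a, IsFinitelyCut (· < ·) {z | tri a z})
      (_ : ∀ a y, a < y → ¬ Alternates (fun z => tri a z) n y)
      {I : Set P} (_ : IsLowerFor (· < ·) I), IsFinitelyCut tri I := by
  induction n with
  | zero =>
    intro P _ tri _ R H hcut halt I hI
    refine ⟨∅, by simp, fun x y _ => ?_⟩
    rcases lt_trichotomy x y with h | rfl | h
    · exact (halt x y h trivial).elim
    · rfl
    · exact (halt y x h trivial).elim
  | succ n ih =>
    intro P _ tri _ R H hcut halt I hI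
    have key : ∀ {tri : P → P → Prop} [IsStrictTotalOrder P tri],
        BackAndForth (· < ·) tri R → (∀ a, IsFinitelyCut (· < ·) {z | tri a z}) →
        (∀ a y, a < y → ¬ Alternates (fun z => tri a z) (n + 1) y) →
        (∀ a, ∃ z, a < z ∧ ∀ z', z ≤ z' → tri a z') → IsFinitelyCut tri I := by
      intro tri _ H hcut halt hev
      -- A union of classes that is lower for `<` is lower for `tri`. Otherwise the class of `x₀` is
      -- split and the induction hypothesis applies to it.
      by_cases hsat : ∀ x ∈ I, ∀ y, DisagreeEquiv tri x y → y ∈ I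
      · refine IsFinitelyCut.of_isLowerFor fun x hx y hyx => ?_
        by_cases h : DisagreeEquiv tri x y
        · exact hsat x hx y h
        · exact hI x hx y ((lt_iff_tri_of_not_disagreeEquiv fun h' => h h'.symm).2 hyx)
      · push Not at hsat
        obtain ⟨x₀, hx₀, y₀, hxy, hy₀⟩ := hsat
        refine isFinitelyCut_of_class H hcut hI hx₀ hy₀ hxy rfl ?_
        have hX : ∀ a ∈ {z | DisagreeEquiv tri z x₀}, ∀ b ∈ {z | DisagreeEquiv tri z x₀},
            DisagreeEquiv tri a b := fun a ha b hb => H.disagreeEquiv_trans hcut ha hb.symm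
        have hX' : ∀ a ∈ {z | DisagreeEquiv tri z x₀}, ∀ b, DisagreeEquiv tri a b →
            b ∈ {z | DisagreeEquiv tri z x₀} := fun a ha b hb =>
          H.disagreeEquiv_trans hcut hb.symm ha
        have := isStrictTotalOrder_restrict (tri := tri) {z | DisagreeEquiv tri z x₀}
        refine ih (H.restrict fun S hS a a' b b' ha hb haX haX' => ?_)
          (fun a => (hcut a).preimage_val)
          (fun a y hay hn => halt a y hay (alternates_succ_of_class hev hX hay hn))
          fun x hx y hyx => hI x hx y hyx
        exact ⟨fun h => hX' a' haX' b' ((H.disagreeEquiv hS ha hb).1 (hX a haX b h)),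
          fun h => hX' a haX b ((H.disagreeEquiv hS ha hb).2 (hX a' haX' b' h))⟩
    by_cases hsub : ∀ x y : P, ¬ x < y
    · refine ⟨∅, by simp, fun x y _ => ?_⟩
      rw [le_antisymm (not_lt.1 (hsub y x)) (not_lt.1 (hsub x y))]
    push Not at hsub
    obtain ⟨a, b, hab⟩ := hsub
    have transfer : ∀ {tri : P → P → Prop}, BackAndForth (· < ·) tri R →
        (∃ z, a < z ∧ ∀ z', z ≤ z' → tri a z') → ∀ a', ∃ z, a' < z ∧ ∀ z', z ≤ z' → tri a' z' := by
      rintro tri H ⟨z, haz, hz⟩ a'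
      obtain ⟨z', hS⟩ := H.forth _ (H.base a a') ⟨_, rfl⟩ z
      refine ⟨z', (H.map_lt _ hS (a, a') (by simp) (z, z') (by simp)).1 haz, fun y' hy' => ?_⟩
      obtain ⟨y, hS'⟩ := H.back _ hS ⟨_, Or.inl rfl⟩ y'
      exact (H.map_tri _ hS' (a, a') (by simp) (y, y') (by simp)).1
        (hz y ((H.map_le hS' (a := z) (a' := z') (by simp) (by simp)).2 hy'))
    obtain ⟨y, hy, hconst⟩ := (hcut a).eventually_constant (J := Set.Ioi a) ⟨b, hab⟩
    have hneg : ∀ {a z}, a < z → (tri z a ↔ ¬ tri a z) := by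
      intro a z haz
      refine ⟨fun h h' => asymm_of tri h h', fun h => ?_⟩
      rcases trichotomous_of tri a z with h' | rfl | h'
      · exact (h h').elim
      · exact (lt_irrefl _ haz).elim
      · exact h'
    by_cases hay : tri a y
    · exact key H hcut halt (transfer H ⟨y, hy, fun z hz =>
        (hconst z (lt_of_lt_of_le hy hz) hz).2 hay⟩)
    · refine IsFinitelyCut.swap (key H.swap (fun a => ?_) (fun a y hay hn => ?_)
        (transfer H.swap ⟨y, hy, fun z hz => ?_⟩))
      · obtain ⟨𝓘, h1, h2⟩ := (hcut a)
        classical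
        -- The converse segment is the complement of `{z | tri a z}` without the point `a`; the two
        -- added lower sets isolate `a`.
        refine ⟨insert (Set.Iio a) (insert (Set.Iic a) 𝓘), ?_, fun x y h => ?_⟩
        · intro J hJ
          simp only [Finset.mem_insert] at hJ
          rcases hJ with rfl | rfl | hJ
          · exact fun x hx y hy => hy.trans hx
          · exact fun x hx y hy => hy.le.trans hx
          · exact h1 J hJ
        · have e1 := h (Set.Iio a) (by simp)
          have e2 := h (Set.Iic a) (by simp)
          have e3 := h2 x y fun J hJ => h J (by simp [hJ])
          simp only [Set.mem_Iio, Set.mem_Iic, Set.mem_ofPred_eq] at e1 e2 e3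
          have hne : ∀ z, tri z a ↔ z ≠ a ∧ ¬ tri a z := by
            intro z
            refine ⟨fun h => ⟨?_, fun h' => asymm_of tri h h'⟩, fun h => ?_⟩
            · rintro rfl
              exact irrefl_of tri _ h
            · rcases trichotomous_of tri z a with h' | h' | h'
              exacts [h', (h.1 h').elim, (h.2 h').elim]
          have heq : ∀ z, z ≠ a ↔ (z < a ∨ ¬ z ≤ a) := fun z => by
            rw [not_le, lt_or_lt_iff_ne]
          change tri x a ↔ tri y a
          rw [hne, hne, heq, heq, e1, e2, e3]
      · exact halt a y hay (hn.of_iff_not fun z hz => hneg (hay.trans_le hz))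
      · exact (hneg (lt_of_lt_of_le hy hz)).2 fun h => hay
          ((hconst z (lt_of_lt_of_le hy hz) hz).1 h)

/-- In a linear order with a back-and-forth system preserving a second linear order whose final
segments are finitely cut, every lower set is finitely cut for the second order. -/
theorem BackAndForth.isFinitelyCut_of_isLowerFor [IsStrictTotalOrder P tri]
    (H : BackAndForth (· < ·) tri R) (hcut : ∀ a, IsFinitelyCut (· < ·) {z | tri a z})
    {I : Set P} (hI : IsLowerFor (· < ·) I) : IsFinitelyCut tri I := by
  rcases isEmpty_or_nonempty P with hP | ⟨⟨a⟩⟩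
  · exact ⟨∅, by simp, fun x => hP.elim x⟩
  -- The bound found at one point serves for all, since any `b` can be matched with `a`.
  obtain ⟨n, hn⟩ := (hcut a).exists_not_alternates
  refine isFinitelyCut_lower_of_not_alternates n H hcut (fun b y _ hy => ?_) hI
  obtain ⟨y', hS⟩ := H.forth _ (H.base b a) ⟨_, rfl⟩ y
  exact hn y' (H.alternates (w := b) (w' := a) (Q := fun z => tri b z)
    (fun S hS hw z z' hz => H.map_tri S hS _ hw _ hz) hS (y := y) (y' := y')
    (by simp) (by simp) hy)

end Main


/-! ### Substitution in many-sorted formulas -/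

namespace SortedLanguage

section Substitution

variable {S : Type u} {L : SortedLanguage.{u, v, v'} S} {V : Type x} {τ : V → S}

/-- Weakening of a term by one more bound variable. -/
def Term.weaken {Δ : List S} (s : S) : ∀ {s' : S}, Term L τ Δ s' → Term L τ (s :: Δ) s'
  | _, .var i => .var i
  | _, .bvar i => .bvar (Γ := s :: Δ) i.succ
  | _, .app f ts => .app f fun i => (ts i).weaken s

/-- Extension of a substitution of the bound variables under a quantifier. -/
def liftSubst {Γ Δ : List S} (s : S) (σ : ∀ j : Fin Γ.length, Term L τ Δ (Γ.get j)) :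
    ∀ j : Fin (s :: Γ).length, Term L τ (s :: Δ) ((s :: Γ).get j) :=
  Fin.cons (α := fun j => Term L τ (s :: Δ) ((s :: Γ).get j))
    (.bvar (Γ := s :: Δ) ⟨0, Nat.succ_pos _⟩) fun j => (σ j).weaken s

variable {W : Type*} {ρ : W → S}

/-- Simultaneous substitution in a term. -/
def Term.subst {Γ Δ : List S} (g : ∀ i : W, Term L τ Δ (ρ i))
    (σ : ∀ j : Fin Γ.length, Term L τ Δ (Γ.get j)) : ∀ {s : S}, Term L ρ Γ s → Term L τ Δ s
  | _, .var i => g i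
  | _, .bvar j => σ j
  | _, .app f ts => .app f fun i => (ts i).subst g σ

/-- Simultaneous substitution in a formula. -/
def BFormula.subst : ∀ {Γ Δ : List S} (_ : ∀ i : W, Term L τ Δ (ρ i))
    (_ : ∀ j : Fin Γ.length, Term L τ Δ (Γ.get j)), BFormula L ρ Γ → BFormula L τ Δ
  | _, _, _, _, .falsum => .falsum
  | _, _, g, σ, .equal t₁ t₂ => .equal (t₁.subst g σ) (t₂.subst g σ)
  | _, _, g, σ, .rel R ts => .rel R fun i => (ts i).subst g σ
  | _, _, g, σ, .imp φ ψ => .imp (φ.subst g σ) (ψ.subst g σ)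
  | _, _, g, σ, .all s φ => .all s (φ.subst (fun i => (g i).weaken s) (liftSubst s σ))

variable (M : S → Type w) [Struct L M]

theorem Term.eval_weaken {Δ : List S} (a : ∀ i : V, M (τ i)) (b : ∀ j : Fin Δ.length, M (Δ.get j))
    {s s' : S} (c : M s) (t : Term L τ Δ s') :
    (t.weaken s).eval M a (Fin.cons (α := fun i => M ((s :: Δ).get i)) c b) = t.eval M a b := by
  induction t with
  | var i => rfl
  | bvar i => rfl
  | app f ts ih => simp only [weaken, eval, ih]

theorem Term.eval_subst {Γ Δ : List S} (a : ∀ i : V, M (τ i))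
    (b : ∀ j : Fin Δ.length, M (Δ.get j)) (g : ∀ i : W, Term L τ Δ (ρ i))
    (σ : ∀ j : Fin Γ.length, Term L τ Δ (Γ.get j)) {s : S} (t : Term L ρ Γ s) :
    (t.subst g σ).eval M a b = t.eval M (fun i => (g i).eval M a b) fun j => (σ j).eval M a b := by
  induction t with
  | var i => rfl
  | bvar i => rfl
  | app f ts ih => simp only [subst, eval, ih]

theorem BFormula.holds_subst {Γ Δ : List S} (a : ∀ i : V, M (τ i))
    (b : ∀ j : Fin Δ.length, M (Δ.get j)) (g : ∀ i : W, Term L τ Δ (ρ i))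
    (σ : ∀ j : Fin Γ.length, Term L τ Δ (Γ.get j)) (φ : BFormula L ρ Γ) :
    (φ.subst g σ).Holds M a b ↔
      φ.Holds M (fun i => (g i).eval M a b) fun j => (σ j).eval M a b := by
  induction φ generalizing Δ with
  | falsum => rfl
  | equal t₁ t₂ => simp only [subst, Holds, Term.eval_subst]
  | rel R ts => simp only [subst, Holds, Term.eval_subst]
  | imp φ ψ ih₁ ih₂ => simp only [subst, Holds, ih₁, ih₂]
  | all s φ ih =>
    simp only [subst, Holds]
    refine forall_congr' fun c => ?_
    rw [ih]
    simp only [Term.eval_weaken]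
    refine iff_of_eq (congrArg _ (funext fun j => ?_))
    refine Fin.cases rfl (fun j => ?_) j
    exact Term.eval_weaken M a b c (σ j)

variable {M}

/-- Substitution for the free variables of a formula without bound variables. -/
def BFormula.substFree {Δ : List S} (g : ∀ i : W, Term L τ Δ (ρ i)) (φ : BFormula L ρ []) :
    BFormula L τ Δ :=
  φ.subst (Γ := []) g fun j => j.elim0

theorem BFormula.holds_substFree {Δ : List S} (a : ∀ i : V, M (τ i))
    (b : ∀ j : Fin Δ.length, M (Δ.get j)) (g : ∀ i : W, Term L τ Δ (ρ i)) (φ : BFormula L ρ []) :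
    (φ.substFree g).Holds M a b ↔
      φ.Holds M (fun i => (g i).eval M a b) fun j => j.elim0 := by
  rw [substFree, holds_subst]
  exact iff_of_eq (congrArg _ (funext fun j : Fin 0 => j.elim0))

theorem BFormula.exists_conj {F : Set (BFormula L τ [])} (hF : F.Finite) :
    ∃ ψ : BFormula L τ [], ∀ a b, ψ.Holds M a b ↔ ∀ φ ∈ F, φ.Holds M a b := by
  induction F, hF using Set.Finite.induction_on with
  | empty => exact ⟨.imp .falsum .falsum, fun a b => by simp [Holds]⟩
  | @insert φ F _ _ ih =>
    obtain ⟨ψ, hψ⟩ := ih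
    refine ⟨(φ.imp ψ.not).not, fun a b => ?_⟩
    simp only [not, Holds, Set.forall_mem_insert, ← hψ]
    tauto

/-- The assignment of the tuple `a` to the variables and of itself to each parameter. -/
def Tuple.withParams (A : Set (Σ s, M s)) (a : Tuple M τ) :
    Tuple M (Sum.elim τ fun c : A => c.1.1) := fun i => match i with
  | .inl j => a j
  | .inr c => c.1.2

theorem FormulaOver.sat_iff {A : Set (Σ s, M s)} (φ : FormulaOver L A τ) (a : Tuple M τ) :
    φ.Sat a ↔ BFormula.Holds M (a.withParams A) φ fun i => i.elim0 := by
  refine iff_of_eq (congrArg (fun f => BFormula.Holds M f φ fun i => i.elim0) (funext fun i => ?_))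
  rcases i with i | c <;> rfl

end Substitution

/-! ### Extending partial elementary maps by saturation -/

section PartialElementary

variable {S : Type u} (L : SortedLanguage.{u, v, v'} S) {M : S → Type w} [Struct L M]

/-- The pairs in `E` form a partial elementary map. -/
def IsElementary (E : Set (Σ s, M s × M s)) : Prop :=
  ∀ φ : BFormula L (fun e : E => e.1.1) [],
    φ.Holds M (fun e => e.1.2.1) (fun i => i.elim0) ↔
      φ.Holds M (fun e => e.1.2.2) (fun i => i.elim0)

variable {L} {E : Set (Σ s, M s × M s)}

theorem IsElementary.holds_iff (hE : IsElementary L E) {V : Type x} {τ : V → S}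
    {a b : ∀ i : V, M (τ i)} (h : ∀ i, ⟨τ i, a i, b i⟩ ∈ E) (φ : BFormula L τ []) :
    φ.Holds M a (fun i => i.elim0) ↔ φ.Holds M b (fun i => i.elim0) := by
  have := hE (φ.substFree fun i => .var (⟨⟨τ i, a i, b i⟩, h i⟩ : E))
  rwa [BFormula.holds_substFree, BFormula.holds_substFree] at this

theorem IsElementary.swap (hE : IsElementary L E) :
    IsElementary L {e : Σ s, M s × M s | ⟨e.1, e.2.2, e.2.1⟩ ∈ E} := fun φ =>
  (hE.holds_iff (fun e => e.2) φ).symm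

theorem IsElementary.left_unique (hE : IsElementary L E) {s : S} {a a' b : M s}
    (h : ⟨s, a, b⟩ ∈ E) (h' : ⟨s, a', b⟩ ∈ E) : a = a' :=
  (hE (.equal (Γ := []) (s := s) (.var (⟨_, h⟩ : E)) (.var (⟨_, h'⟩ : E)))).2 rfl

/-- In a saturated structure a small partial elementary map extends to any further element. -/
theorem IsElementary.exists_insert (hM : IsSaturated L M) (hE : IsElementary L E)
    (hsmall : Cardinal.mk E < Cardinal.mk (Σ s, M s)) {s : S} (c : M s) :
    ∃ d : M s, IsElementary L (insert ⟨s, c, d⟩ E) := by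
  let B : Set (Σ s, M s) := (fun e => ⟨e.1, e.2.2⟩) '' E
  have hB : IsSmall B := Cardinal.mk_image_le.trans_lt hsmall
  have hname : ∀ b : B, ∃ e : M b.1.1, ⟨b.1.1, e, b.1.2⟩ ∈ E := by
    rintro ⟨_, e, he, rfl⟩
    exact ⟨e.2.1, he⟩
  choose r hr using hname
  let τ : Fin 1 → S := fun _ => s
  let val : Tuple M (Sum.elim τ fun b : B => b.1.1) := fun i => match i with
    | .inl _ => c
    | .inr b => r b
  -- The type of `c` over the domain of the map, transported to parameters in its range.
  let q : CompleteType L M B τ :=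
    { formulas := {ψ | BFormula.Holds M val ψ fun i => i.elim0}
      finitelySatisfiable := by
        intro F hF hfin
        obtain ⟨ψ, hψ⟩ := BFormula.exists_conj (M := M) hfin
        -- If the conjunction `ψ` had no solution, the formula "no `y` satisfies `ψ`" would transfer
        -- back along `E` and be refuted by `c`.
        by_contra hcon
        let g : ∀ i : Fin 1 ⊕ B, Term L (fun e : E => e.1.1) [s]
            (Sum.elim τ (fun b : B => b.1.1) i) := fun i => match i with
          | .inl _ => .bvar (Γ := [s]) ⟨0, Nat.one_pos⟩
          | .inr b => .var (⟨_, hr b⟩ : E)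
        have hall := hE (.all s (ψ.substFree g).not)
        simp only [BFormula.Holds, BFormula.not, BFormula.holds_substFree] at hall
        refine hall.2 (fun y hy => hcon ⟨fun _ => y, fun φ hφ => ?_⟩) c ?_
        · have := (hψ _ _).1 hy φ hφ
          unfold FormulaOver.Sat
          convert this using 2 with i
          rcases i with i | b <;> rfl
        · have := (hψ val _).2 fun φ hφ => hF hφ
          convert this using 2 with i
          rcases i with i | b <;> rfl
      complete := fun φ => Classical.em _ }
  obtain ⟨d, hd⟩ := hM B hB 1 τ q
  have hq : ∀ ψ : FormulaOver L B τ, (BFormula.Holds M val ψ fun i => i.elim0) ↔ ψ.Sat d := by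
    intro ψ
    refine ⟨fun h => hd ψ h, fun h => ?_⟩
    by_contra hcon
    exact hd ψ.not hcon h
  refine ⟨d 0, fun φ => ?_⟩
  have hsub : ∀ e : (insert ⟨s, c, d 0⟩ E : Set (Σ s, M s × M s)),
      ∃ t : Term L (Sum.elim τ fun b : B => b.1.1) [] e.1.1,
        t.eval (Γ := []) M val (fun i => i.elim0) = e.1.2.1 ∧
        t.eval (Γ := []) M (Tuple.withParams B d) (fun i => i.elim0) = e.1.2.2 := by
    rintro ⟨e, rfl | he⟩
    · exact ⟨.var (τ := Sum.elim τ fun b : B => b.1.1) (.inl 0), rfl, rfl⟩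
    · refine ⟨.var (τ := Sum.elim τ fun b : B => b.1.1) (.inr ⟨⟨e.1, e.2.2⟩, e, he, rfl⟩), ?_, rfl⟩
      -- `r` picked some preimage of this parameter; injectivity of the map identifies it with the
      -- one in `e`.
      exact hE.left_unique (hr ⟨⟨e.1, e.2.2⟩, e, he, rfl⟩) he
  choose t ht1 ht2 using hsub
  have := hq (φ.substFree t)
  simp only [FormulaOver.sat_iff] at this
  rw [BFormula.holds_substFree, BFormula.holds_substFree] at this
  simpa only [ht1, ht2] using this

/-- The pairs of corresponding entries of two tuples. -/
def entryPairs {n : ℕ} {τ : Fin n → S} (a b : Tuple M τ) : Set (Σ s, M s × M s) :=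
  Set.range fun j => ⟨τ j, a j, b j⟩

/-- Entries are added one at a time; since the structure is infinite, finitely many extra pairs keep
the map small. -/
theorem IsElementary.exists_union (hM : IsSaturated L M) (hE : IsElementary L E)
    (hsmall : Cardinal.mk E < Cardinal.mk (Σ s, M s)) [Infinite (Σ s, M s)]
    {n : ℕ} {τ : Fin n → S} (c : Tuple M τ) :
    ∃ d : Tuple M τ, IsElementary L (E ∪ entryPairs c d) := by
  classical
  have key : ∀ J : Finset (Fin n), ∃ d : Tuple M τ,
      IsElementary L (E ∪ (fun j => ⟨τ j, c j, d j⟩) '' (J : Set (Fin n))) := by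
    intro J
    induction J using Finset.induction_on with
    | empty => exact ⟨c, by simpa using hE⟩
    | insert j J hj ih =>
      obtain ⟨d, hd⟩ := ih
      have hlt := (Cardinal.mk_union_le E
          ((fun j => ⟨τ j, c j, d j⟩) '' (J : Set (Fin n)))).trans_lt
        (Cardinal.add_lt_of_lt (Cardinal.aleph0_le_mk _) hsmall
          (((J.finite_toSet.image _).lt_aleph0).trans_le (Cardinal.aleph0_le_mk _)))
      obtain ⟨y, hy⟩ := hd.exists_insert hM hlt (c j)
      refine ⟨Function.update d j y, ?_⟩
      have himg : (fun i => (⟨τ i, c i, Function.update d j y i⟩ : Σ s, M s × M s)) ''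
          (J : Set (Fin n)) = (fun i => ⟨τ i, c i, d i⟩) '' (J : Set (Fin n)) := by
        refine Set.image_congr fun i hi => ?_
        rw [Function.update_of_ne]
        rintro rfl
        exact hj hi
      rw [Finset.coe_insert, Set.image_insert_eq, himg, Function.update_self, Set.union_insert]
      exact hy
  obtain ⟨d, hd⟩ := key Finset.univ
  exact ⟨d, by simpa [entryPairs] using hd⟩

end PartialElementary

/-! ### Homogeneity of the locus and conclusion -/

section Locus

variable {S : Type u} {L : SortedLanguage.{u, v, v'} S} {M : S → Type w} [Struct L M]
  {A : Set (Σ s, M s)} {n : ℕ} {τ : Fin n → S} {p : CompleteType L M A τ}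

/-- The identity on `A` together with the pairs of corresponding entries of the pairs of tuples
in `T`. -/
def pairsOver (A : Set (Σ s, M s)) {P : Set (Tuple M τ)} (T : Set (P × P)) :
    Set (Σ s, M s × M s) :=
  (fun e => ⟨e.1, e.2, e.2⟩) '' A ∪ ⋃ t ∈ T, entryPairs t.1.1 t.2.1

theorem const_mem_pairsOver {P : Set (Tuple M τ)} {T : Set (P × P)} (c : A) :
    ⟨c.1.1, c.1.2, c.1.2⟩ ∈ pairsOver A T :=
  Or.inl ⟨c.1, c.2, rfl⟩

theorem entry_mem_pairsOver {P : Set (Tuple M τ)} {T : Set (P × P)} {t : P × P} (ht : t ∈ T)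
    (j : Fin n) : ⟨τ j, t.1.1 j, t.2.1 j⟩ ∈ pairsOver A T :=
  Or.inr (Set.mem_biUnion ht ⟨j, rfl⟩)

theorem pairsOver_insert {P : Set (Tuple M τ)} {T : Set (P × P)} {t : P × P} :
    pairsOver A (insert t T) = pairsOver A T ∪ entryPairs t.1.1 t.2.1 := by
  rw [pairsOver, pairsOver, Set.biUnion_insert, Set.union_assoc, Set.union_comm (entryPairs _ _)]

theorem mk_pairsOver_lt [Infinite (Σ s, M s)] (hA : IsSmall A) {P : Set (Tuple M τ)}
    {T : Set (P × P)} (hT : T.Finite) :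
    Cardinal.mk (pairsOver A T) < Cardinal.mk (Σ s, M s) := by
  refine (Cardinal.mk_union_le _ _).trans_lt (Cardinal.add_lt_of_lt (Cardinal.aleph0_le_mk _)
    (Cardinal.mk_image_le.trans_lt hA) ?_)
  exact (hT.biUnion fun t _ => Set.finite_range _).lt_aleph0.trans_le (Cardinal.aleph0_le_mk _)

theorem CompleteType.sat_iff_mem {a : Tuple M τ} (ha : a ∈ p.locus) (φ : FormulaOver L A τ) :
    φ.Sat a ↔ φ ∈ p.formulas := by
  refine ⟨fun h => (p.complete φ).resolve_right fun h' => ha _ h' h, ha φ⟩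

/-- A formula about these pairs becomes an `L_A`-formula in one tuple, which `p` decides in the same
way for `a` and `b`. -/
theorem isElementary_pairsOver_singleton (a b : p.locus) :
    IsElementary L (pairsOver A {(a, b)}) := by
  intro φ
  have hsub : ∀ e : pairsOver A {(a, b)},
      ∃ t : Term L (Sum.elim τ fun c : A => c.1.1) [] e.1.1,
        t.eval (Γ := []) M (Tuple.withParams A a.1) (fun i => i.elim0) = e.1.2.1 ∧
        t.eval (Γ := []) M (Tuple.withParams A b.1) (fun i => i.elim0) = e.1.2.2 := by
    rintro ⟨e, ⟨c, hc, rfl⟩ | he⟩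
    · exact ⟨.var (τ := Sum.elim τ fun c : A => c.1.1) (.inr ⟨c, hc⟩), rfl, rfl⟩
    · simp only [Set.mem_singleton_iff, Set.iUnion_iUnion_eq_left] at he
      obtain ⟨j, rfl⟩ := he
      exact ⟨.var (τ := Sum.elim τ fun c : A => c.1.1) (.inl j), rfl, rfl⟩
  choose t ht1 ht2 using hsub
  have := (CompleteType.sat_iff_mem a.2 (φ.substFree t)).trans
    (CompleteType.sat_iff_mem b.2 (φ.substFree t)).symm
  simp only [FormulaOver.sat_iff] at this
  rw [BFormula.holds_substFree, BFormula.holds_substFree] at this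
  simpa only [ht1, ht2] using this

theorem RelDefinableRel.iff_of_isElementary {r : p.locus → p.locus → Prop}
    (hr : RelDefinableRel L A r) {T : Set (p.locus × p.locus)} (hT : IsElementary L (pairsOver A T))
    {s t : p.locus × p.locus} (hs : s ∈ T) (ht : t ∈ T) : r s.1 t.1 ↔ r s.2 t.2 := by
  obtain ⟨_, ⟨φ, rfl⟩, h⟩ := hr
  rw [h, h]
  refine hT.holds_iff (fun i => ?_) φ
  rcases i with (j | j) | c
  · exact entry_mem_pairsOver hs j
  · exact entry_mem_pairsOver ht j
  · exact const_mem_pairsOver c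

theorem mem_locus_of_isElementary {E : Set (Σ s, M s × M s)} (hE : IsElementary L E)
    (hA : ∀ c : A, ⟨c.1.1, c.1.2, c.1.2⟩ ∈ E) {a b : Tuple M τ}
    (hab : ∀ j, ⟨τ j, a j, b j⟩ ∈ E) (ha : a ∈ p.locus) : b ∈ p.locus := by
  intro φ hφ
  refine (hE.holds_iff (fun i => ?_) φ).1 (ha φ hφ)
  rcases i with j | c
  · exact hab j
  · exact hA c

/-- Inverting the map lets `back` follow from the extension statement used for `forth`. -/
theorem swap_pairsOver {P : Set (Tuple M τ)} {T : Set (P × P)} :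
    {e : Σ s, M s × M s | ⟨e.1, e.2.2, e.2.1⟩ ∈ pairsOver A T} =
      pairsOver A (Prod.swap ⁻¹' T) := by
  have key : ∀ (T : Set (P × P)) (e : Σ s, M s × M s), e ∈ pairsOver A T →
      ⟨e.1, e.2.2, e.2.1⟩ ∈ pairsOver A (Prod.swap ⁻¹' T) := by
    rintro T e (⟨c, hc, rfl⟩ | he)
    · exact const_mem_pairsOver ⟨c, hc⟩
    · simp only [Set.mem_iUnion] at he
      obtain ⟨t, ht, j, rfl⟩ := he
      exact entry_mem_pairsOver (t := t.swap) (by simpa using ht) j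
  ext e
  exact ⟨fun h => key T _ h, fun h => key _ e h⟩

theorem exists_insert_pairsOver [Infinite (Σ s, M s)] (hM : IsSaturated L M) (hA : IsSmall A)
    {T : Set (p.locus × p.locus)} (hfin : T.Finite) (hT : IsElementary L (pairsOver A T))
    (c : p.locus) : ∃ d : p.locus, IsElementary L (pairsOver A (insert (c, d) T)) := by
  obtain ⟨d, hd⟩ := hT.exists_union hM (mk_pairsOver_lt hA hfin) c.1
  have hdl : d ∈ p.locus := mem_locus_of_isElementary hd
    (fun c => Or.inl (const_mem_pairsOver c)) (fun j => Or.inr ⟨j, rfl⟩) c.2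
  exact ⟨⟨d, hdl⟩, by rwa [pairsOver_insert]⟩

/-- Finite partial elementary maps over `A` form a back-and-forth system on the locus of a
complete type over the small set `A`. -/
theorem backAndForth_locus [Infinite (Σ s, M s)] (hM : IsSaturated L M) (hA : IsSmall A)
    {r tri : p.locus → p.locus → Prop} (hr : RelDefinableRel L A r)
    (htri : RelDefinableRel L A tri) :
    BackAndForth r tri fun T => T.Finite ∧ IsElementary L (pairsOver A T) where
  base a b := ⟨Set.finite_singleton _, isElementary_pairsOver_singleton a b⟩
  forth T hT _ c := (exists_insert_pairsOver hM hA hT.1 hT.2 c).imp fun _ hd => ⟨hT.1.insert _, hd⟩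
  back T hT _ d := by
    have hT' := hT.2.swap
    rw [swap_pairsOver] at hT'
    obtain ⟨c, hc⟩ := exists_insert_pairsOver hM hA
      (hT.1.preimage Prod.swap_injective.injOn) hT' d
    have hc' := hc.swap
    rw [swap_pairsOver] at hc'
    refine ⟨c, hT.1.insert _, ?_⟩
    convert hc' using 2
    ext ⟨a, b⟩
    simp [and_comm]
  map_lt T hT a ha b hb := hr.iff_of_isElementary hT.2 ha hb
  map_tri T hT a ha b hb := htri.iff_of_isElementary hT.2 ha hb

/-- The entries of `a` become parameters, so weak o-minimality for one order applies to the final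
segments of the other. -/
theorem RelDefinableRel.relDefinableSet {P : Set (Tuple M τ)} {r : P → P → Prop}
    (hr : RelDefinableRel L A r) (a : P) :
    RelDefinableSet L (Set.univ : Set (Σ s, M s)) {z | r a z} := by
  obtain ⟨_, ⟨φ, rfl⟩, h⟩ := hr
  let U : Set (Σ s, M s) := Set.univ
  let g : ∀ i : (Fin n ⊕ Fin n) ⊕ A, Term L (Sum.elim τ fun c : U => c.1.1) []
      (Sum.elim (Sum.elim τ τ) (fun c : A => c.1.1) i) := fun i => match i with
    | .inl (.inl j) => .var (τ := Sum.elim τ fun c : U => c.1.1) (.inr ⟨⟨τ j, a.1 j⟩, trivial⟩)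
    | .inl (.inr j) => .var (τ := Sum.elim τ fun c : U => c.1.1) (.inl j)
    | .inr c => .var (τ := Sum.elim τ fun c : U => c.1.1) (.inr ⟨c.1, trivial⟩)
  refine ⟨_, ⟨φ.substFree g, rfl⟩, fun z => ?_⟩
  refine (h a z).trans ?_
  simp only [Set.mem_ofPred_eq, FormulaOver.Sat]
  rw [BFormula.holds_substFree]
  refine iff_of_eq (congrArg (fun f => BFormula.Holds M f φ fun i => i.elim0) (funext fun i => ?_))
  rcases i with (j | j) | c <;> rfl

theorem IsWeaklyOMinimalPair.of_isRelDefinableLinearOrder (hM : IsSaturated L M) (hA : IsSmall A)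
    {lt tri : p.locus → p.locus → Prop} (hlt : IsWeaklyOMinimalPair p lt)
    (htri : IsRelDefinableLinearOrder L A tri) : IsWeaklyOMinimalPair p tri := by
  refine ⟨htri, fun X hX => ?_⟩
  -- Over a finite structure there are only finitely many sets of tuples; the cardinal arithmetic of
  -- the extension argument needs the infinite case.
  rcases finite_or_infinite (Σ s, M s) with hfin | hinf
  · have : ∀ s, Finite (M s) := fun s => Finite.of_injective (Sigma.mk s) sigma_mk_injective
    exact Set.toFinite _
  have := hlt.1.2
  have := htri.2
  classical
  let _ := linearOrderOfSTO lt
  have H := backAndForth_locus hM hA hlt.1.1 htri.1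
  have hcut : ∀ {X : Set p.locus}, RelDefinableSet L (Set.univ : Set (Σ s, M s)) X →
      IsFinitelyCut lt X := fun hX => isFinitelyCut_of_finite_components (hlt.2 _ hX)
  exact ((hcut hX).trans fun I hI => BackAndForth.isFinitelyCut_of_isLowerFor
    (tri := tri) H (fun a => hcut (htri.1.relDefinableSet a)) hI).finite_components

end Locus

end SortedLanguage

theorem mainTheorem10 {S : Type u} (L : SortedLanguage.{u, v, v'} S) (M : S → Type w)
    [SortedLanguage.Struct L M] (hM : SortedLanguage.IsSaturated L M)
    (A : Set (Σ s, M s)) (hA : SortedLanguage.IsSmall A)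
    {n : ℕ} {τ : Fin n → S} (p : SortedLanguage.CompleteType L M A τ) :
    (∀ lt : p.locus → p.locus → Prop, SortedLanguage.IsWeaklyOMinimalPair p lt →
      ∀ tri : p.locus → p.locus → Prop, SortedLanguage.IsRelDefinableLinearOrder L A tri →
        SortedLanguage.IsWeaklyOMinimalPair p tri) ∧
    (∀ tri : p.locus → p.locus → Prop, SortedLanguage.IsRelDefinableLinearOrder L A tri →
      (p.IsWeaklyOMinimal ↔ SortedLanguage.IsWeaklyOMinimalPair p tri)) := by
  refine ⟨fun lt hlt tri htri => hlt.of_isRelDefinableLinearOrder hM hA htri, fun tri htri => ?_⟩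
  exact ⟨fun ⟨_, hlt⟩ => hlt.of_isRelDefinableLinearOrder hM hA htri, fun h => ⟨tri, h⟩⟩
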